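/- Let $X\subset\mathbb R^d$ be a compact convex set, let $\|\cdot\|$ be a norm on $\mathbb R^d$ with dual norm $\|\cdot\|_*$, and let $\psi$ be a convex function that is differentiable on $X$ and $1$-strongly convex on $X$ with respect to $\|\cdot\|$, i.e. $\psi(y)\ge\psi(x)+\langle\nabla\psi(x),y-x\rangle+\frac12\|y-x\|^2$ for $x,y\in X$. Let $D(x,y)=\psi(x)-\psi(y)-\langle\nabla\psi(y),x-y\rangle$ and let $R\ge 0$ be such that $D(x,y)\le\frac12R^2$ for all $x,y\in X$. Let $\Pi$ be a probability distribution on a measurable space $\Xi$, let $F(\cdot;\xi)$, $\xi\in\Xi$, be convex functions on $X$ such that for each $x\in X$ the function $F(x;\cdot)$ is measurable and $\Pi$-integrable, and let $f(x)=\mathbb E_\Pi[F(x;\xi)]$. Let $\xi_1,\xi_2,\dots$ be a stochastic process in $\Xi$ with law $P$. Put $\mathcal F_s=\sigma(\xi_1,\dots,\xi_s)$ for $s\ge0$, and let $P^t_{[s]}$ be a regular conditional distribution of $\xi_t$ given $\mathcal F_s$ (assumed to exist). Let $d_{TV}(Q,Q')=2\sup_A|Q(A)-Q'(A)|$. Let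 $\mathsf G(x;\xi)$ be a measurable selection of subgradients of $F(\cdot;\xi)$ at $x\in X$, let $\alpha(1)\ge\alpha(2)\ge\cdots>0$ be stepsizes, let $x(1)\in X$ be a deterministic point, and for $t\ge1$ let $$g(t)=\mathsf G(x(t);\xi_t),\qquad x(t+1)=\operatorname*{argmin}_{x\in X}\Big\{\langle g(t),x\rangle+\tfrac1{\alpha(t)}D(x,x(t))\Big\}.$$ Assume the following. (Lipschitz losses) There is $G<\infty$ such that $F(\cdot;\xi)$ is $G$-Lipschitz on $X$ with respect to $\|\cdot\|$ for $\Pi$-almost every $\xi$, and such that for each $t\ge1$, almost surely, $F(\cdot;\xi_t)$ is $G$-Lipschitz on $X$ and $\|\mathsf G(x;\xi_t)\|_*\le G$ for all $x\in X$. (Uniform mixing) The mixing time given the first $s$ samples is $\tau_{mix}(P_{[s]},\epsilon)=\min\{k\ge1: d_{TV}(P^{s+k}_{[s]},\Pi)\le\epsilon\}$. For every $\epsilon>0$ there is a finite integer $\tau_{mix}(\epsilon)$ such that, almost surely, $\tau_{mix}(P_{[s]},\epsilon)\le\tau_{mix}(\epsilon)$ and $d_{TV}(P^{s+\tau_{mix}(\epsilon)}_{[s]},\Pi)\le\epsilon$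 for all $s\ge0$. Let $x^\star\in X$, $\delta\in(0,1)$, and let $T\in\mathbb N$ and $\epsilon>0$ satisfy $\tau_{mix}(\epsilon)\le T/2$. Then, with probability at least $1-\delta$, the average $\hat x(T)=\frac1T\sum_{t=1}^Tx(t)$ satisfies $$f(\hat x(T))-f(x^\star)\le\frac{R^2}{2T\alpha(T)}+\frac{G^2}{2T}\sum_{t=1}^T\alpha(t)+\frac{\tau_{mix}(\epsilon)-1}{T}\Big[G^2\sum_{t=1}^T\alpha(t)+GR\Big]+\epsilon GR+4GR\sqrt{\frac{\tau_{mix}(\epsilon)\log\frac{\tau_{mix}(\epsilon)}{\delta}}{T}}.$$ -/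

import Mathlib

open MeasureTheory
open scoped NNReal ENNReal

noncomputable section

namespace EMD

section Optimization

variable {E : Type*} [NormedAddCommGroup E] [NormedSpace ℝ E]

/-- Subdifferential at `x` of a real function `h` on `X`, as a set of continuous linear
functionals; the dual norm of a subgradient is its operator norm. -/
def subdifferential (X : Set E) (h : E → ℝ) (x : E) : Set (E →L[ℝ] ℝ) :=
  {v | ∀ y ∈ X, h x + v (y - x) ≤ h y}

/-- Bregman divergence `ψ x - ψ y - ⟨∇ψ y, x - y⟩` of a function `ψ` on `X`. For `x, y` in a convex
set `X` on which `ψ` is differentiable, the value on `x - y` of a derivative of `ψ` within `X` at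
`y` does not depend on which derivative is taken, even when `X` has empty interior. -/
def bregman (X : Set E) (ψ : E → ℝ) (x y : E) : ℝ :=
  ψ x - ψ y - fderivWithin ℝ ψ X y (x - y)

/-- `ψ` is a prox-function on `X` of radius `R`: convex and differentiable on `X`, `1`-strongly
convex with respect to the norm, with Bregman divergence at most `R ^ 2 / 2` on `X`. -/
structure IsProxFunction (X : Set E) (ψ : E → ℝ) (R : ℝ) : Prop where
  convexOn : ConvexOn ℝ X ψ
  differentiableOn : DifferentiableOn ℝ ψ X
  stronglyConvex : ∀ x ∈ X, ∀ y ∈ X,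
    ψ x + fderivWithin ℝ ψ X x (y - x) + (1 / 2) * ‖y - x‖ ^ 2 ≤ ψ y
  radius : ∀ x ∈ X, ∀ y ∈ X, bregman X ψ x y ≤ (1 / 2) * R ^ 2

/-- A positive stepsize sequence `α 1, α 2, …` that is non-increasing. -/
structure IsStepsize (α : ℕ → ℝ) : Prop where
  pos : ∀ t, 1 ≤ t → 0 < α t
  noninc : ∀ s t, 1 ≤ s → s ≤ t → α t ≤ α s

/-- `z` minimizes `⟨v, ·⟩ + (1 / a) D(·, x)` over `X`. -/
def IsMirrorStep (X : Set E) (ψ : E → ℝ) (a : ℝ) (v : E →L[ℝ] ℝ) (x z : E) : Prop :=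
  z ∈ X ∧ ∀ y ∈ X, v z + (1 / a) * bregman X ψ z x ≤ v y + (1 / a) * bregman X ψ y x

/-- The iterates `x 1, x 2, …` of ergodic mirror descent, started at the deterministic point `x₁`
and driven by the samples `ξ 1, ξ 2, …` through the subgradient selection `g`. -/
structure IsErgodicMirrorDescent {S Ω : Type*} (X : Set E) (ψ : E → ℝ) (α : ℕ → ℝ)
    (g : E → S → (E →L[ℝ] ℝ)) (ξ : ℕ → Ω → S) (x₁ : E) (x : ℕ → Ω → E) : Prop where
  init_mem : x₁ ∈ X
  init : ∀ ω, x 1 ω = x₁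
  step : ∀ t, 1 ≤ t → ∀ ω,
    IsMirrorStep X ψ (α t) (g (x t ω) (ξ t ω)) (x t ω) (x (t + 1) ω)

/-- The average `(1 / T) ∑_{t = 1}^T x t` of the first `T` iterates. -/
def average {Ω : Type*} (x : ℕ → Ω → E) (T : ℕ) (ω : Ω) : E :=
  (1 / (T : ℝ)) • ∑ t ∈ Finset.Icc 1 T, x t ω

/-- The objective `f x = E_π [F (x; ξ)]`. -/
def objective {S : Type*} [MeasurableSpace S] (F : E → S → ℝ) (π : Measure S) (x : E) : ℝ :=
  ∫ z, F x z ∂π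

/-- At the sample point `z`, the function `F (·; z)` is `G`-Lipschitz on `X` and `g (·; z)` selects
a subgradient of dual norm at most `G` at every point of `X`. -/
structure LipschitzAt {S : Type*} (X : Set E) (F : E → S → ℝ) (g : E → S → (E →L[ℝ] ℝ))
    (G : ℝ≥0) (z : S) : Prop where
  lipschitz : LipschitzOnWith G (fun x => F x z) X
  subgradient : ∀ x ∈ X, g x z ∈ subdifferential X (fun y => F y z) x
  dual_norm_le : ∀ x ∈ X, ‖g x z‖ ≤ G

end Optimization

section Mixing

variable {S Ω : Type*} [MeasurableSpace S] [MeasurableSpace Ω]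

/-- The `σ`-field generated by the samples `ξ 1, …, ξ s` (trivial for `s = 0`). -/
abbrev past (ξ : ℕ → Ω → S) (s : ℕ) : MeasurableSpace Ω :=
  ⨆ i ∈ Set.Icc 1 s, MeasurableSpace.comap (ξ i) inferInstance

/-- `κ` is a regular conditional distribution of `ξ t` given `ξ 1, …, ξ s`. -/
structure IsCondLaw (P : Measure Ω) (ξ : ℕ → Ω → S) (s t : ℕ) (κ : Ω → Measure S) : Prop where
  isProbabilityMeasure : ∀ ω, IsProbabilityMeasure (κ ω)
  measurable : ∀ A, MeasurableSet A → Measurable[past ξ s] (fun ω => κ ω A)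
  condProb : ∀ A, MeasurableSet A →
    (fun ω => (κ ω).real A) =ᵐ[P] P[(ξ t ⁻¹' A).indicator (fun _ => (1 : ℝ)) | past ξ s]

/-- Total variation distance, normalized as `2 sup_A |P A - Q A| = ∫ |p - q| dμ`. -/
def tvDist (P Q : Measure S) : ℝ :=
  2 * ⨆ A : {A : Set S // MeasurableSet A}, |P.real A.1 - Q.real A.1|

/-- Total variation mixing time given the first `s` samples: the smallest number `k ≥ 1` of
additional steps after which the conditional law of the sample is `ε`-close to `π`
(`⊤` if there is none). Here `κ s t ω` is the law of `ξ t` given `ξ 1, …, ξ s`. -/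
def tvMixingTime (κ : ℕ → ℕ → Ω → Measure S) (π : Measure S) (s : ℕ) (ε : ℝ) (ω : Ω) : ℕ∞ :=
  ⨅ k ∈ {k : ℕ | 1 ≤ k ∧ tvDist (κ s (s + k) ω) π ≤ ε}, (k : ℕ∞)

/-- `τ` is a uniform total variation mixing time: for every `ε > 0`, almost surely `τ ε` bounds the
mixing times given the first `s` samples for all `s`, and the conditional law of the sample `τ ε`
steps ahead is indeed `ε`-close to `π`. (The second clause follows from the first when the distance
to `π` is non-increasing in the number of steps, as for a homogeneous Markov chain with stationary
law `π`; for a general process a bound on the first time of closeness says nothing about closeness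
at later times.) -/
structure IsUniformMixingTime (P : Measure Ω) (κ : ℕ → ℕ → Ω → Measure S) (π : Measure S)
    (τ : ℝ → ℕ) : Prop where
  mixingTime_le : ∀ ε, 0 < ε → ∀ᵐ ω ∂P, ∀ s : ℕ, tvMixingTime κ π s ε ω ≤ (τ ε : ℕ∞)
  close : ∀ ε, 0 < ε → ∀ᵐ ω ∂P, ∀ s : ℕ, tvDist (κ s (s + τ ε) ω) π ≤ ε

end Mixing

end EMD

end

/-! Given the past, `F (x t) (ξ t)` is a biased sample of `f (x t)`, since `ξ t` is correlated with
earlier samples. The cure is to look `k = τ ε` steps ahead: `x (s + 1)` is determined by `ξ 1, …, ξ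
s`, and given these the law of `ξ (s + k)` is `ε`-close to `π`.

For the first `N = T + 1 - k` iterates, the excess risk of `x (s + 1)` splits into four terms: (a)
the bias of replacing `π` by the conditional law, at most `ε G R`
(`abs_integral_sub_le_mul_tvDist`); (b) the prediction error, conditional mean minus realized value,
on the loss at `ξ (s + k)`; (c) the cost of evaluating that loss at `x (s + 1)` instead of `x (s +
k)`: the iterates are `k - 1` short steps apart (`IsMirrorStep.norm_sub_le`); (d) the usual regret
of mirror descent (`IsErgodicMirrorDescent.regret_le`). The last `k - 1` iterates cost at most `G R`
each, and Jensen's inequality passes to the average.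

Only (b) is random in an essential way. Errors `k` apart are martingale differences, so each residue
class modulo `k` has a sub-Gaussian sum by conditional Hoeffding. The `k` dependent classes are
merged by adding the square roots of their parameters (`hasSubgaussianMGF_sum_predictionError`), and
a Chernoff bound finishes. -/

namespace EMD

/-! ### One step of mirror descent: optimality, stability, progress. -/

section MirrorStep

open Filter Topology

variable {E : Type*} [NormedAddCommGroup E] [NormedSpace ℝ E] {X : Set E} {ψ : E → ℝ} {R : ℝ}

lemma bregman_self (X : Set E) (ψ : E → ℝ) (x : E) : bregman X ψ x x = 0 := by
  simp [bregman]

lemma bregman_three_point (X : Set E) (ψ : E → ℝ) (x y z : E) :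
    bregman X ψ y x - bregman X ψ y z - bregman X ψ z x =
      fderivWithin ℝ ψ X z (y - z) - fderivWithin ℝ ψ X x (y - z) := by
  simp only [bregman, map_sub]
  ring

lemma IsProxFunction.half_sq_norm_le_bregman (hψ : IsProxFunction X ψ R) {x y : E}
    (hx : x ∈ X) (hy : y ∈ X) : (1 / 2) * ‖x - y‖ ^ 2 ≤ bregman X ψ x y := by
  have := hψ.stronglyConvex y hy x hx
  unfold bregman
  linarith

lemma IsProxFunction.bregman_nonneg (hψ : IsProxFunction X ψ R) {x y : E}
    (hx : x ∈ X) (hy : y ∈ X) : 0 ≤ bregman X ψ x y :=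
  le_trans (by positivity) (hψ.half_sq_norm_le_bregman hx hy)

lemma IsProxFunction.norm_sub_le (hψ : IsProxFunction X ψ R) (hR : 0 ≤ R) {x y : E}
    (hx : x ∈ X) (hy : y ∈ X) : ‖x - y‖ ≤ R := by
  have h1 := hψ.half_sq_norm_le_bregman hx hy
  have h2 := hψ.radius x hx y hy
  exact abs_le_of_sq_le_sq' (by linarith) hR |>.2

/-- Difference quotients along a segment of `X` converge to the derivative within `X`. -/
lemma tendsto_difference_quotient (hXconvex : Convex ℝ X) (hψ : DifferentiableOn ℝ ψ X) {x y : E}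
    (hx : x ∈ X) (hy : y ∈ X) :
    Tendsto (fun n : ℕ => ((n : ℝ) + 1) * (ψ (x + (1 / ((n : ℝ) + 1)) • (y - x)) - ψ x)) atTop
      (𝓝 (fderivWithin ℝ ψ X x (y - x))) := by
  have h := (hψ x hx).hasFDerivWithinAt
  have := h.lim (l := atTop) (c := fun n : ℕ => (n : ℝ) + 1)
    (d := fun n : ℕ => (1 / ((n : ℝ) + 1)) • (y - x)) (v := y - x) ?_ ?_ ?_
  · simpa [smul_eq_mul] using this
  · have h0 : Tendsto (fun n : ℕ => (1 / ((n : ℝ) + 1)) • (y - x)) atTop (𝓝 ((0 : ℝ) • (y - x))) :=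
      tendsto_one_div_add_atTop_nhds_zero_nat.smul_const _
    simpa using h0
  · refine Eventually.of_forall fun n => ?_
    have hn : (0 : ℝ) < (n : ℝ) + 1 := by positivity
    refine hXconvex.add_smul_sub_mem hx hy ⟨by positivity, ?_⟩
    rw [div_le_one hn]; linarith [Nat.cast_nonneg (α := ℝ) n]
  · refine tendsto_const_nhds.congr fun n => ?_
    have hn : ((n : ℝ) + 1) ≠ 0 := by positivity
    rw [smul_smul, mul_one_div_cancel hn, one_smul]

/-- First-order optimality of `z`, tested along the segment from `z` to `y`: the difference
quotients of the objective are nonnegative, hence so is their limit. The three-point identity turns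
the gradients into divergences. -/
lemma IsMirrorStep.mul_apply_sub_le (hXconvex : Convex ℝ X) (hψ : IsProxFunction X ψ R) {a : ℝ}
    (ha : 0 < a) {v : E →L[ℝ] ℝ} {x z : E} (hz : IsMirrorStep X ψ a v x z) {y : E} (hy : y ∈ X) :
    a * v (z - y) ≤ bregman X ψ y x - bregman X ψ y z - bregman X ψ z x := by
  rw [bregman_three_point]
  have hlim := tendsto_difference_quotient hXconvex hψ.differentiableOn hz.1 hy
  have hlow : a * v (z - y) + fderivWithin ℝ ψ X x (y - z) ≤ fderivWithin ℝ ψ X z (y - z) := by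
    refine ge_of_tendsto hlim (Eventually.of_forall fun n => ?_)
    have hn : (0 : ℝ) < (n : ℝ) + 1 := by positivity
    have hmem : z + (1 / ((n : ℝ) + 1)) • (y - z) ∈ X := by
      refine hXconvex.add_smul_sub_mem hz.1 hy ⟨by positivity, ?_⟩
      rw [div_le_one hn]; linarith [Nat.cast_nonneg (α := ℝ) n]
    have h := hz.2 _ hmem
    have h' := mul_le_mul_of_nonneg_left h ha.le
    simp only [bregman, map_add, map_sub, map_smul, smul_eq_mul] at h' ⊢
    have h'' := mul_le_mul_of_nonneg_left h' hn.le
    field_simp at h'' ⊢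
    linarith
  linarith

/-- Optimality of `z` tested at `z'` leaves `bregman X ψ z' z ≤ 0`, and strong convexity makes this
`z' = z`. -/
lemma IsMirrorStep.unique (hXconvex : Convex ℝ X) (hψ : IsProxFunction X ψ R) {a : ℝ}
    (ha : 0 < a) {v : E →L[ℝ] ℝ} {x z z' : E} (hz : IsMirrorStep X ψ a v x z)
    (hz' : z' ∈ X) (hle : v z' + (1 / a) * bregman X ψ z' x ≤ v z + (1 / a) * bregman X ψ z x) :
    z' = z := by
  have h1 := hz.mul_apply_sub_le hXconvex hψ ha hz'
  have h2 := mul_le_mul_of_nonneg_left hle ha.le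
  have h3 := hψ.half_sq_norm_le_bregman hz' hz.1
  rw [map_sub] at h1
  field_simp at h2
  have h4 : ‖z' - z‖ ^ 2 ≤ 0 := by linarith
  have h5 : ‖z' - z‖ = 0 := by
    have := sq_nonneg ‖z' - z‖
    exact pow_eq_zero_iff (two_ne_zero) |>.1 (le_antisymm h4 this)
  exact sub_eq_zero.1 (norm_eq_zero.1 h5)

/-- Optimality tested at the starting point `x` leaves both `bregman X ψ x z` and `bregman X ψ z x`,
so strong convexity gives `‖x - z‖ ^ 2 ≤ a * v (x - z)`. -/
lemma IsMirrorStep.norm_sub_le (hXconvex : Convex ℝ X) (hψ : IsProxFunction X ψ R) {a : ℝ}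
    (ha : 0 < a) {v : E →L[ℝ] ℝ} {x z : E} (hz : IsMirrorStep X ψ a v x z) (hx : x ∈ X) {G : ℝ}
    (hv : ‖v‖ ≤ G) : ‖x - z‖ ≤ a * G := by
  have h1 := hz.mul_apply_sub_le hXconvex hψ ha hx
  have h2 := hψ.half_sq_norm_le_bregman hx hz.1
  have h3 := hψ.half_sq_norm_le_bregman hz.1 hx
  rw [bregman_self] at h1
  rw [norm_sub_rev z x] at h3
  have h4 : v (x - z) ≤ G * ‖x - z‖ :=
    (le_abs_self _).trans ((v.le_opNorm _).trans (by gcongr))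
  have h5 : v (z - x) = - v (x - z) := by rw [← map_neg, neg_sub]
  rw [h5] at h1
  have h6 : ‖x - z‖ * ‖x - z‖ ≤ (a * G) * ‖x - z‖ := by nlinarith
  rcases (norm_nonneg (x - z)).eq_or_lt with h | h
  · rw [← h]; exact mul_nonneg ha.le ((norm_nonneg v).trans hv)
  · exact le_of_mul_le_mul_right h6 h

/-- Split `v (x - y)` at `z`. The part `v (x - z)` is paid for by Young's inequality, whose
quadratic term is absorbed by `- bregman X ψ z x`. -/
lemma IsMirrorStep.apply_sub_le (hXconvex : Convex ℝ X) (hψ : IsProxFunction X ψ R) {a : ℝ}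
    (ha : 0 < a) {v : E →L[ℝ] ℝ} {x z : E} (hz : IsMirrorStep X ψ a v x z) (hx : x ∈ X) {G : ℝ}
    (hv : ‖v‖ ≤ G) {y : E} (hy : y ∈ X) :
    v (x - y) ≤ (1 / a) * (bregman X ψ y x - bregman X ψ y z) + G ^ 2 / 2 * a := by
  have h1 := hz.mul_apply_sub_le hXconvex hψ ha hy
  have h3 := hψ.half_sq_norm_le_bregman hz.1 hx
  rw [norm_sub_rev z x] at h3
  have h4 : v (x - z) ≤ G * ‖x - z‖ :=
    (le_abs_self _).trans ((v.le_opNorm _).trans (by gcongr))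
  have h5 : v (x - y) = v (x - z) + v (z - y) := by rw [← map_add, sub_add_sub_cancel]
  have h6 : a * v (x - y) ≤ bregman X ψ y x - bregman X ψ y z + G ^ 2 / 2 * a * a := by
    rw [h5]
    nlinarith [sq_nonneg (‖x - z‖ - a * G)]
  calc v (x - y) = (1 / a) * (a * v (x - y)) := by field_simp
    _ ≤ (1 / a) * (bregman X ψ y x - bregman X ψ y z + G ^ 2 / 2 * a * a) := by gcongr
    _ = _ := by field_simp

end MirrorStep

/-- Summation by parts for a bounded sequence against the differences weighted by reciprocals of
a non-increasing stepsize. -/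
lemma IsStepsize.sum_one_div_mul_sub_le {α : ℕ → ℝ} (hα : IsStepsize α) {D : ℕ → ℝ} {B : ℝ}
    {m : ℕ} (hm : 1 ≤ m) (h0 : ∀ t, 1 ≤ t → 0 ≤ D t) (hB : ∀ t, 1 ≤ t → D t ≤ B) {n : ℕ}
    (hmn : m ≤ n) :
    ∑ t ∈ Finset.Icc m n, (1 / α t) * (D t - D (t + 1)) ≤ B / α n := by
  -- The discarded term `D (n + 1)` is kept so that the induction closes.
  suffices h : ∑ t ∈ Finset.Icc m n, (1 / α t) * (D t - D (t + 1)) ≤ (B - D (n + 1)) / α n by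
    refine h.trans ?_
    have := hα.pos n (hm.trans hmn)
    gcongr
    linarith [h0 (n + 1) (by omega)]
  induction n, hmn using Nat.le_induction with
  | base =>
    have := hα.pos m hm
    simp only [Finset.Icc_self, Finset.sum_singleton]
    rw [one_div_mul_eq_div]
    gcongr
    exact hB m hm
  | succ n hmn ih =>
    rw [Finset.sum_Icc_succ_top (by omega)]
    have h1 := hα.pos n (hm.trans hmn)
    have h2 := hα.pos (n + 1) (by omega)
    have h3 : 1 / α n ≤ 1 / α (n + 1) :=
      one_div_le_one_div_of_le h2 (hα.noninc n (n + 1) (hm.trans hmn) (by omega))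
    have h4 := mul_le_mul_of_nonneg_left h3 (sub_nonneg.2 (hB (n + 1) (by omega)))
    simp only [div_eq_mul_one_div (_ - _ : ℝ)] at ih ⊢
    nlinarith

/-! ### Measurability of the argmin. -/

section Measurability

open Filter Topology

variable {E : Type*} [NormedAddCommGroup E] [NormedSpace ℝ E] {X : Set E} {ψ : E → ℝ} {R : ℝ}

lemma continuousOn_mirrorStep_objective (hψ : ContinuousOn ψ X) (a : ℝ) (v : E →L[ℝ] ℝ) (x : E) :
    ContinuousOn (fun y => v y + (1 / a) * bregman X ψ y x) X := by
  unfold bregman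
  fun_prop

omit [NormedSpace ℝ E] in
lemma le_of_forall_dense_le {Φ : E → ℝ} (hΦ : ContinuousOn Φ X) {D : Set E} (hDX : D ⊆ X)
    (hD : X ⊆ closure D) {b : ℝ} (h : ∀ y ∈ D, b ≤ Φ y) {y : E} (hy : y ∈ X) : b ≤ Φ y := by
  have : (𝓝[D] y).NeBot := mem_closure_iff_nhdsWithin_neBot.1 (hD hy)
  have ht : Tendsto Φ (𝓝[D] y) (𝓝 (Φ y)) := (hΦ y hy).mono_left (nhdsWithin_mono _ hDX)
  exact ge_of_tendsto ht (eventually_nhdsWithin_of_forall h)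

omit [NormedSpace ℝ E] in
lemma exists_dense_lt {Φ : E → ℝ} {C : Set E} (hΦ : ContinuousOn Φ C) {D : Set E}
    (hDC : D ⊆ C) (hD : C ⊆ closure D) {y : E} (hy : y ∈ C) {b : ℝ} (hb : Φ y < b) :
    ∃ c ∈ D, Φ c < b := by
  by_contra! h
  exact absurd (le_of_forall_dense_le hΦ hDC hD h hy) (not_le.2 hb)

variable [FiniteDimensional ℝ E] [MeasurableSpace E] [BorelSpace E]
  {Ω : Type*} [MeasurableSpace Ω]

omit [NormedSpace ℝ E] [FiniteDimensional ℝ E] in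
lemma measurable_comp_of_continuousOn {f : E → ℝ} (hf : ContinuousOn f X) {x : Ω → E}
    (hx : Measurable x) (hxX : ∀ ω, x ω ∈ X) : Measurable fun ω => f (x ω) :=
  (continuousOn_iff_continuous_domRestrict.1 hf).measurable.comp (hx.subtype_mk (h := hxX))

/-- Only the derivative in the direction `y - x ω` enters, and it is a pointwise limit of measurable
difference quotients inside `X`. -/
lemma measurable_bregman (hXconvex : Convex ℝ X) (hψ : DifferentiableOn ℝ ψ X) {x : Ω → E}
    (hx : Measurable x) (hxX : ∀ ω, x ω ∈ X) {y : E} (hy : y ∈ X) :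
    Measurable fun ω => bregman X ψ y (x ω) := by
  have h1 : Measurable fun ω => ψ (x ω) := measurable_comp_of_continuousOn hψ.continuousOn hx hxX
  have h2 : Measurable fun ω => fderivWithin ℝ ψ X (x ω) (y - x ω) := by
    refine measurable_of_tendsto_metrizable (f := fun (n : ℕ) ω =>
      ((n : ℝ) + 1) * (ψ (x ω + (1 / ((n : ℝ) + 1)) • (y - x ω)) - ψ (x ω))) (fun n => ?_)
      (tendsto_pi_nhds.2 fun ω => tendsto_difference_quotient hXconvex hψ (hxX ω) hy)
    refine ((measurable_comp_of_continuousOn hψ.continuousOn ?_ fun ω => ?_).sub h1).const_mul _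
    · fun_prop
    · have hn : (0 : ℝ) < (n : ℝ) + 1 := by positivity
      refine hXconvex.add_smul_sub_mem (hxX ω) hy ⟨by positivity, ?_⟩
      rw [div_le_one hn]; linarith [Nat.cast_nonneg (α := ℝ) n]
  unfold bregman
  exact (h1.const_sub _).sub h2

/-- Minimizers of the mirror descent step depend measurably on the data. -/
lemma measurable_of_isMirrorStep (hXcompact : IsCompact X) (hXconvex : Convex ℝ X)
    (hψ : IsProxFunction X ψ R) {a : ℝ} (ha : 0 < a) {x z : Ω → E} (hx : Measurable x)
    (hxX : ∀ ω, x ω ∈ X) {v : Ω → E →L[ℝ] ℝ} (hv : ∀ y, Measurable fun ω => v ω y)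
    (hz : ∀ ω, IsMirrorStep X ψ a (v ω) (x ω) (z ω)) : Measurable z := by
  set Φ : Ω → E → ℝ := fun ω y => v ω y + (1 / a) * bregman X ψ y (x ω) with hΦ
  have hcont : ∀ ω, ContinuousOn (Φ ω) X := fun ω =>
    continuousOn_mirrorStep_objective hψ.differentiableOn.continuousOn a (v ω) (x ω)
  have hmeas : ∀ y ∈ X, Measurable fun ω => Φ ω y := fun y hy =>
    (hv y).add ((measurable_bregman hXconvex hψ.differentiableOn hx hxX hy).const_mul _)
  refine measurable_of_isClosed fun C hC => ?_
  obtain ⟨D, hDX, hDc, hD⟩ :=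
    (TopologicalSpace.IsSeparable.of_separableSpace X).exists_countable_dense_subset
  obtain ⟨K, hKC, hKc, hK⟩ :=
    (TopologicalSpace.IsSeparable.of_separableSpace (X ∩ C)).exists_countable_dense_subset
  -- The unique minimizer lies in `C` iff points of `X ∩ C` come arbitrarily close to the minimum
  -- over `X`. Compactness gives a minimizer on `X ∩ C`, uniqueness identifies it with `z ω`, and
  -- continuity reduces everything to countable dense sets.
  have hset : z ⁻¹' C = ⋂ n : ℕ, ⋃ c ∈ K, ⋂ y ∈ D, {ω | Φ ω c < Φ ω y + 1 / ((n : ℝ) + 1)} := by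
    ext ω
    simp only [Set.mem_preimage, Set.mem_iInter, Set.mem_iUnion, Set.mem_ofPred_eq, exists_prop]
    constructor
    · intro hzC n
      have hn : (0 : ℝ) < 1 / ((n : ℝ) + 1) := by positivity
      obtain ⟨c, hcK, hc⟩ := exists_dense_lt ((hcont ω).mono Set.inter_subset_left) hKC hK
        (y := z ω) ⟨(hz ω).1, hzC⟩ (lt_add_of_pos_right (Φ ω (z ω)) hn)
      exact ⟨c, hcK, fun y hy => hc.trans_le (by gcongr; exact (hz ω).2 y (hDX hy))⟩
    · intro h
      have hle : ∀ n : ℕ, ∃ c ∈ X ∩ C, Φ ω c - 1 / ((n : ℝ) + 1) ≤ Φ ω (z ω) := by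
        intro n
        obtain ⟨c, hcK, hc⟩ := h n
        exact ⟨c, hKC hcK, le_of_forall_dense_le (hcont ω) hDX hD
          (fun y hy => by linarith [hc y hy]) (hz ω).1⟩
      obtain ⟨c₀, hc₀, -⟩ := hle 0
      obtain ⟨p, hp, hmin⟩ := (hXcompact.inter_right hC).exists_isMinOn ⟨c₀, hc₀⟩
        ((hcont ω).mono Set.inter_subset_left)
      have hpz : Φ ω p ≤ Φ ω (z ω) := by
        have ht : Tendsto (fun n : ℕ => Φ ω p - 1 / ((n : ℝ) + 1)) atTop (𝓝 (Φ ω p)) := by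
          simpa using tendsto_const_nhds.sub (tendsto_one_div_add_atTop_nhds_zero_nat (𝕜 := ℝ))
        refine le_of_tendsto ht (Eventually.of_forall fun n => ?_)
        obtain ⟨c, hc, hcz⟩ := hle n
        have : Φ ω p ≤ Φ ω c := hmin hc
        linarith
      rw [← (hz ω).unique hXconvex hψ ha hp.1 hpz]
      exact hp.2
  rw [hset]
  refine MeasurableSet.iInter fun n => MeasurableSet.biUnion hKc fun c hc =>
    MeasurableSet.biInter hDc fun y hy => measurableSet_lt (hmeas c (hKC hc).1)
      ((hmeas y (hDX hy)).add_const _)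

end Measurability

/-! ### The filtration of the samples and predictability. -/

section Past

variable {S Ω : Type*} [MeasurableSpace S]

lemma past_mono (ξ : ℕ → Ω → S) {s t : ℕ} (h : s ≤ t) : past ξ s ≤ past ξ t :=
  biSup_mono fun _ hi => ⟨hi.1, hi.2.trans h⟩

lemma past_le [mΩ : MeasurableSpace Ω] {ξ : ℕ → Ω → S} (hξ : ∀ t, Measurable (ξ t)) (s : ℕ) :
    past ξ s ≤ mΩ :=
  iSup₂_le fun i _ => (hξ i).comap_le

lemma measurable_past (ξ : ℕ → Ω → S) {s t : ℕ} (hs : 1 ≤ s) (hst : s ≤ t) :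
    Measurable[past ξ t] (ξ s) :=
  measurable_iff_comap_le.2 (le_biSup (fun i => MeasurableSpace.comap (ξ i) inferInstance)
    (show s ∈ Set.Icc 1 t from ⟨hs, hst⟩))

variable {E : Type*} [NormedAddCommGroup E] [NormedSpace ℝ E] {X : Set E} {ψ : E → ℝ} {R : ℝ}
  {α : ℕ → ℝ} {g : E → S → (E →L[ℝ] ℝ)} {ξ : ℕ → Ω → S} {x₁ : E} {x : ℕ → Ω → E}

omit [MeasurableSpace S] in
lemma IsErgodicMirrorDescent.mem (hx : IsErgodicMirrorDescent X ψ α g ξ x₁ x) {t : ℕ} (ht : 1 ≤ t)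
    (ω : Ω) : x t ω ∈ X := by
  obtain ⟨s, rfl⟩ := Nat.exists_eq_add_of_le' ht
  cases s with
  | zero => rw [zero_add, hx.init]; exact hx.init_mem
  | succ s => exact (hx.step (s + 1) (by omega) ω).1

/-- The iterates of ergodic mirror descent are predictable. -/
lemma IsErgodicMirrorDescent.measurable [FiniteDimensional ℝ E] [MeasurableSpace E] [BorelSpace E]
    (hx : IsErgodicMirrorDescent X ψ α g ξ x₁ x) (hXcompact : IsCompact X)
    (hXconvex : Convex ℝ X) (hψ : IsProxFunction X ψ R) (hα : IsStepsize α)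
    (hgmeas : Measurable (fun p : X × S => g p.1 p.2)) (s : ℕ) :
    Measurable[past ξ s] (x (s + 1)) := by
  induction s with
  | zero =>
    have : x (0 + 1) = fun _ => x₁ := funext hx.init
    rw [this]
    exact measurable_const
  | succ s ih =>
    have ih' : Measurable[past ξ (s + 1)] (x (s + 1)) := ih.mono (past_mono ξ (by omega)) le_rfl
    have hξs := measurable_past ξ (show 1 ≤ s + 1 by omega) le_rfl
    let _ : MeasurableSpace Ω := past ξ (s + 1)
    have hmem := hx.mem (show 1 ≤ s + 1 by omega)
    have hg : Measurable fun ω => g (x (s + 1) ω) (ξ (s + 1) ω) :=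
      hgmeas.comp ((ih'.subtype_mk (h := hmem)).prodMk hξs)
    refine measurable_of_isMirrorStep hXcompact hXconvex hψ (hα.pos (s + 1) (by omega)) ih' hmem
      (fun y => ?_) (hx.step (s + 1) (by omega))
    exact (ContinuousLinearMap.measurable_apply y).comp hg

end Past

/-! ### Integrals against laws close in total variation. -/

section TotalVariation

variable {S : Type*} [MeasurableSpace S]

lemma two_mul_abs_sub_le_tvDist (Q π : Measure S) [IsProbabilityMeasure Q] [IsProbabilityMeasure π]
    {A : Set S} (hA : MeasurableSet A) : 2 * |Q.real A - π.real A| ≤ tvDist Q π := by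
  refine mul_le_mul_of_nonneg_left ?_ zero_le_two
  refine le_ciSup (f := fun A : {A : Set S // MeasurableSet A} => |Q.real A.1 - π.real A.1|)
    ⟨1, ?_⟩ ⟨A, hA⟩
  rintro _ ⟨B, rfl⟩
  simp only
  rw [abs_le]
  have h1 := measureReal_le_one (μ := Q) (s := B.1)
  have h2 := measureReal_le_one (μ := π) (s := B.1)
  have h3 := measureReal_nonneg (μ := Q) (s := B.1)
  have h4 := measureReal_nonneg (μ := π) (s := B.1)
  constructor <;> linarith

/-- Layer cake for `h + M`, with values in `[0, 2M]`: the two measures of each superlevel set differ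
by at most `tvDist Q π / 2`, over an interval of length `2M`. -/
lemma abs_integral_sub_le_mul_tvDist (Q π : Measure S) [IsProbabilityMeasure Q]
    [IsProbabilityMeasure π] {h : S → ℝ} (hm : Measurable h) {M : ℝ} (hM : ∀ z, |h z| ≤ M) :
    |∫ z, h z ∂Q - ∫ z, h z ∂π| ≤ M * tvDist Q π := by
  have hM0 : 0 ≤ M := by
    obtain ⟨z⟩ := (inferInstance : NeZero π).out |> fun hπ => Measure.nonempty_of_neZero π
    exact (abs_nonneg _).trans (hM z)
  have hint : ∀ (μ : Measure S) [IsProbabilityMeasure μ], Integrable h μ := fun μ _ =>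
    Integrable.of_bound hm.aestronglyMeasurable M (ae_of_all _ hM)
  have hanti : ∀ (μ : Measure S) [IsProbabilityMeasure μ],
      IntegrableOn (fun t : ℝ => μ.real {z | t ≤ h z + M}) (Set.Ioc 0 (2 * M)) := by
    intro μ _
    have : Antitone fun t : ℝ => μ.real {z | t ≤ h z + M} := fun a b hab =>
      measureReal_mono fun z hz => le_trans hab hz
    exact ((this.locallyIntegrable (μ := volume)).integrableOn_isCompact
      (isCompact_Icc (a := 0) (b := 2 * M))).mono_set Set.Ioc_subset_Icc_self
  have hcake : ∀ (μ : Measure S) [IsProbabilityMeasure μ],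
      ∫ z, h z ∂μ + M = ∫ t in Set.Ioc 0 (2 * M), μ.real {z | t ≤ h z + M} := by
    intro μ _
    rw [← Integrable.integral_eq_integral_Ioc_meas_le (f := fun z => h z + M)
      ((hint μ).add (integrable_const M))
      (ae_of_all _ fun z => by simpa using by linarith [(abs_le.1 (hM z)).1])
      (ae_of_all _ fun z => by simpa using by linarith [(abs_le.1 (hM z)).2]),
      integral_add (hint μ) (integrable_const M)]
    simp
  have hdiff : ∫ z, h z ∂Q - ∫ z, h z ∂π = ∫ t in Set.Ioc 0 (2 * M),
      (Q.real {z | t ≤ h z + M} - π.real {z | t ≤ h z + M}) := by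
    rw [integral_sub (hanti Q) (hanti π), ← hcake, ← hcake]
    ring
  rw [hdiff, ← Real.norm_eq_abs]
  refine (norm_setIntegral_le_of_norm_le_const (C := tvDist Q π / 2) measure_Ioc_lt_top fun t _ => ?_).trans ?_
  · have := two_mul_abs_sub_le_tvDist Q π
      (measurableSet_le measurable_const (hm.add_const M) : MeasurableSet {z | t ≤ h z + M})
    rw [Real.norm_eq_abs]
    linarith
  · simp only [measureReal_def, Real.volume_Ioc, sub_zero]
    rw [ENNReal.toReal_ofReal (by positivity)]
    apply le_of_eq; ring

end TotalVariation

/-! ### Conditional Hoeffding lemma from a disintegration. -/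

section Disintegration

open ProbabilityTheory

variable {Ω Ω' S : Type*} [MeasurableSpace Ω] [MeasurableSpace Ω'] [MeasurableSpace S]
  {P : Measure Ω} [IsProbabilityMeasure P] {q : Ω → Ω'} {Y : Ω → S} {κ : Kernel Ω' S}
  [IsMarkovKernel κ]

lemma measurable_integral_kernel {H : Ω' × S → ℝ} (hH : Measurable H) :
    Measurable fun w => ∫ z, H (w, z) ∂κ w :=
  hH.stronglyMeasurable.integral_kernel_prod_right'.measurable

/-- Agreement on rectangles suffices. `Ω'` is kept apart from `Ω` so that it can later be `Ω` with
the smaller σ-field `past ξ s`, and `q` the identity. -/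
lemma map_prodMk_eq_compProd (hq : Measurable q) (hY : Measurable Y)
    (h : ∀ B A, MeasurableSet B → MeasurableSet A →
      P (q ⁻¹' B ∩ Y ⁻¹' A) = ∫⁻ ω in q ⁻¹' B, κ (q ω) A ∂P) :
    P.map (fun ω => (q ω, Y ω)) = (P.map q) ⊗ₘ κ := by
  have := Measure.isProbabilityMeasure_map (μ := P) hq.aemeasurable
  have := Measure.isProbabilityMeasure_map (μ := P) (hq.prodMk hY).aemeasurable
  refine Measure.ext_prod fun {B A} hB hA => ?_
  rw [Measure.map_apply (hq.prodMk hY) (hB.prod hA), Measure.compProd_apply_prod hB hA,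
    setLIntegral_map hB (κ.measurable_coe hA) hq, ← h B A hB hA]
  rfl

/-- Conditional Hoeffding lemma, for a random variable `Y` with conditional law `κ (q ω)`. -/
lemma lintegral_mul_exp_integral_sub_le (hq : Measurable q) (hY : Measurable Y)
    (h : P.map (fun ω => (q ω, Y ω)) = (P.map q) ⊗ₘ κ)
    {W : Ω' → ℝ≥0∞} (hW : Measurable W) {H : Ω' × S → ℝ} (hH : Measurable H) {M : ℝ}
    (hM : ∀ p, |H p| ≤ M) (r : ℝ) :
    ∫⁻ ω, W (q ω) * ENNReal.ofReal (Real.exp (r * (∫ z, H (q ω, z) ∂κ (q ω) - H (q ω, Y ω)))) ∂P ≤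
      ENNReal.ofReal (Real.exp (M ^ 2 * r ^ 2 / 2)) * ∫⁻ ω, W (q ω) ∂P := by
  have := Measure.isProbabilityMeasure_map (μ := P) hq.aemeasurable
  have hφ := measurable_integral_kernel (κ := κ) hH
  -- The weight `W` will be the exponential of the earlier errors; with values in `ℝ≥0∞` its
  -- integrability is not needed.
  set Φ : Ω' × S → ℝ≥0∞ := fun p =>
    W p.1 * ENNReal.ofReal (Real.exp (r * (∫ z, H (p.1, z) ∂κ p.1 - H p))) with hΦ
  have hΦm : Measurable Φ := by
    have : Measurable fun p : Ω' × S => ∫ z, H (p.1, z) ∂κ p.1 := hφ.comp measurable_fst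
    fun_prop
  calc ∫⁻ ω, Φ (q ω, Y ω) ∂P = ∫⁻ p, Φ p ∂(P.map (fun ω => (q ω, Y ω))) :=
        (lintegral_map hΦm (hq.prodMk hY)).symm
    _ = ∫⁻ w, ∫⁻ z, Φ (w, z) ∂κ w ∂(P.map q) := by rw [h, Measure.lintegral_compProd hΦm]
    _ ≤ ∫⁻ w, ENNReal.ofReal (Real.exp (M ^ 2 * r ^ 2 / 2)) * W w ∂(P.map q) := by
        refine lintegral_mono fun w => ?_
        have hHw : Measurable fun z => H (w, z) := hH.comp measurable_prodMk_left
        have hsub := ((hasSubgaussianMGF_of_mem_Icc (μ := κ w) hHw.aemeasurable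
          (ae_of_all _ fun z => abs_le.1 (hM (w, z))))).neg
        have hmgf := hsub.mgf_le r
        have hint := hsub.integrable_exp_mul r
        -- Hoeffding's parameter is the squared half-length of `[-M, M]`.
        have hpar : ((‖M - -M‖₊ / 2) ^ 2 : ℝ≥0) = (M ^ 2 : ℝ) := by
          simp only [NNReal.coe_pow, NNReal.coe_div, coe_nnnorm, Real.norm_eq_abs]
          rw [show M - -M = 2 * M by ring, abs_mul, div_pow, mul_pow, sq_abs, sq_abs]
          norm_num
        rw [hpar] at hmgf
        simp only [hΦ]
        rw [lintegral_const_mul _ (by fun_prop), mul_comm]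
        gcongr
        have heq : ∀ z, r * (∫ z, H (w, z) ∂κ w - H (w, z)) =
            r * (-fun z => H (w, z) - ∫ z, H (w, z) ∂κ w) z := fun z => by
          simp
        simp_rw [heq]
        rw [← ofReal_integral_eq_lintegral_ofReal hint (ae_of_all _ fun z => (Real.exp_pos _).le)]
        exact ENNReal.ofReal_le_ofReal hmgf
    _ = _ := by
        rw [lintegral_const_mul _ hW, lintegral_map hW hq]

end Disintegration

/-! ### Conditional laws of the process as kernels on the past. -/

section CondLaw

open ProbabilityTheory

variable {S Ω : Type*} [MeasurableSpace S] [mΩ : MeasurableSpace Ω] {P : Measure Ω}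
  [IsProbabilityMeasure P] {ξ : ℕ → Ω → S} {s t : ℕ} {κ : Ω → Measure S}

/-- A conditional law as a Markov kernel on the past. -/
def IsCondLaw.kernel (hκ : IsCondLaw P ξ s t κ) : @Kernel Ω S (past ξ s) _ :=
  @Kernel.mk Ω S (past ξ s) _ κ
    (@Measure.measurable_of_measurable_coe S Ω _ (past ξ s) κ hκ.measurable)

lemma IsCondLaw.measure_inter_preimage (hκ : IsCondLaw P ξ s t κ) (hξ : ∀ t, Measurable (ξ t))
    {B : Set Ω} (hB : MeasurableSet[past ξ s] B) {A : Set S} (hA : MeasurableSet A) :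
    P (B ∩ ξ t ⁻¹' A) = ∫⁻ ω in B, κ ω A ∂P := by
  have hle := past_le hξ s
  have hprob := hκ.isProbabilityMeasure
  have hind : Integrable ((ξ t ⁻¹' A).indicator fun _ => (1 : ℝ)) P :=
    (integrable_const _).indicator (hξ t hA)
  have hreal : ∫ ω in B, (κ ω).real A ∂P = P.real (B ∩ ξ t ⁻¹' A) := by
    rw [setIntegral_congr_ae (g := P[(ξ t ⁻¹' A).indicator (fun _ => (1 : ℝ)) | past ξ s])
      (hle B hB) ((hκ.condProb A hA).mono fun ω h _ => h), setIntegral_condExp hle hind hB,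
      setIntegral_indicator (hξ t hA)]
    simp
  have hm : Measurable fun ω => κ ω A := (hκ.measurable A hA).mono hle le_rfl
  have hlint : (∫ ω in B, (κ ω).real A ∂P) = (∫⁻ ω in B, κ ω A ∂P).toReal :=
    integral_toReal hm.aemeasurable (ae_of_all _ fun ω => measure_lt_top _ _)
  have hfin : ∫⁻ ω in B, κ ω A ∂P ≠ ∞ := by
    refine ((lintegral_mono fun ω => (prob_le_one : κ ω A ≤ 1)).trans_lt ?_).ne
    simp
  rw [← ENNReal.toReal_eq_toReal_iff' (measure_ne_top _ _) hfin, ← hlint, hreal]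
  rfl

/-- Conditional Hoeffding lemma for the process. -/
lemma IsCondLaw.lintegral_mul_exp_integral_sub_le (hκ : IsCondLaw P ξ s t κ)
    (hξ : ∀ t, Measurable (ξ t)) {W : Ω → ℝ≥0∞} (hW : Measurable[past ξ s] W) {H : Ω × S → ℝ}
    (hH : @Measurable _ _ ((past ξ s).prod inferInstance) _ H) {M : ℝ} (hM : ∀ p, |H p| ≤ M)
    (r : ℝ) :
    ∫⁻ ω, W ω * ENNReal.ofReal (Real.exp (r * (∫ z, H (ω, z) ∂κ ω - H (ω, ξ t ω)))) ∂P ≤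
      ENNReal.ofReal (Real.exp (M ^ 2 * r ^ 2 / 2)) * ∫⁻ ω, W ω ∂P := by
  have hq : @Measurable Ω Ω mΩ (past ξ s) id := measurable_id'' (past_le hξ s)
  have hmarkov : @IsMarkovKernel Ω S (past ξ s) _ hκ.kernel :=
    @IsMarkovKernel.mk Ω S (past ξ s) _ hκ.kernel hκ.isProbabilityMeasure
  exact @EMD.lintegral_mul_exp_integral_sub_le Ω Ω S mΩ (past ξ s) _ P _ id (ξ t) hκ.kernel hmarkov
    hq (hξ t) (@map_prodMk_eq_compProd Ω Ω S mΩ (past ξ s) _ P _ id (ξ t) hκ.kernel hmarkov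
      hq (hξ t) fun B A hB hA => hκ.measure_inter_preimage hξ hB hA) W hW H hH M hM r

omit [IsProbabilityMeasure P] in
lemma IsCondLaw.measurable_integral_sub (hκ : IsCondLaw P ξ s t κ) {u : ℕ} (hsu : s ≤ u) (ht : 1 ≤ t) (htu : t ≤ u) {H : Ω × S → ℝ}
    (hH : @Measurable _ _ ((past ξ s).prod inferInstance) _ H) :
    Measurable[past ξ u] fun ω => ∫ z, H (ω, z) ∂κ ω - H (ω, ξ t ω) := by
  have hmarkov : @IsMarkovKernel Ω S (past ξ s) _ hκ.kernel :=
    @IsMarkovKernel.mk Ω S (past ξ s) _ hκ.kernel hκ.isProbabilityMeasure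
  have h1 : Measurable[past ξ s] fun ω => ∫ z, H (ω, z) ∂κ ω :=
    @measurable_integral_kernel Ω S (past ξ s) _ hκ.kernel hmarkov H hH
  have h2 : @Measurable Ω (Ω × S) (past ξ u) ((past ξ s).prod inferInstance)
      fun ω => (ω, ξ t ω) :=
    Measurable.prodMk (measurable_id'' (past_mono ξ hsu)) (measurable_past ξ ht htu)
  exact (h1.mono (past_mono ξ hsu) le_rfl).sub (hH.comp h2)

end CondLaw

/-! ### Sub-Gaussian sums without independence. -/

section SubGaussian

open ProbabilityTheory

variable {Ω : Type*} [MeasurableSpace Ω] {P : Measure Ω}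

lemma hasSubgaussianMGF_of_lintegral_le {U : Ω → ℝ} (hU : Measurable U) {c : ℝ≥0}
    (h : ∀ r : ℝ, ∫⁻ ω, ENNReal.ofReal (Real.exp (r * U ω)) ∂P ≤
      ENNReal.ofReal (Real.exp (c * r ^ 2 / 2))) : HasSubgaussianMGF U c P := by
  have hm : ∀ r : ℝ, Measurable fun ω => Real.exp (r * U ω) := fun r => by fun_prop
  refine ⟨fun r => ⟨(hm r).aestronglyMeasurable, ?_⟩, fun r => ?_⟩
  · rw [hasFiniteIntegral_iff_ofReal (ae_of_all _ fun ω => (Real.exp_pos _).le)]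
    exact (h r).trans_lt ENNReal.ofReal_lt_top
  · unfold mgf
    rw [integral_eq_lintegral_of_nonneg_ae (ae_of_all _ fun ω => (Real.exp_pos _).le)
      (hm r).aestronglyMeasurable]
    exact ENNReal.toReal_le_of_le_ofReal (Real.exp_pos _).le (h r)

/-- Without any independence, the sum of `k` sub-Gaussian variables with parameter `c` is
sub-Gaussian with parameter `k ^ 2 * c`. -/
lemma hasSubgaussianMGF_sum_range [IsProbabilityMeasure P] {B : ℕ → Ω → ℝ} {c : ℝ≥0}
    (h : ∀ i, HasSubgaussianMGF (B i) c P) (k : ℕ) :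
    HasSubgaussianMGF (fun ω => ∑ i ∈ Finset.range k, B i ω) ((k : ℝ≥0) ^ 2 * c) P := by
  induction k with
  | zero => simp
  | succ k ih =>
    have := ih.add (h k)
    simp_rw [Finset.sum_range_succ]
    -- Square roots of the parameters add, as norms do: `(k √c + √c) ^ 2 = (k + 1) ^ 2 c`.
    convert! this using 1
    rw [NNReal.sqrt_mul, NNReal.sqrt_sq, ← add_one_mul, mul_pow, NNReal.sq_sqrt]
    push_cast
    rfl

end SubGaussian

lemma sum_range_mul_eq_sum_residues (Z : ℕ → ℝ) (k n : ℕ) :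
    ∑ s ∈ Finset.range (k * n), Z s =
      ∑ i ∈ Finset.range k, ∑ j ∈ Finset.range n, Z (i + j * k) := by
  induction n with
  | zero => simp
  | succ n ih =>
    simp_rw [Finset.sum_range_succ, Finset.sum_add_distrib]
    rw [mul_add_one, Finset.sum_range_add, ih]
    congr 1
    exact Finset.sum_congr rfl fun i _ => by rw [add_comm, mul_comm]

/-! ### Concentration of the prediction errors. -/

section Concentration

open ProbabilityTheory

variable {S Ω : Type*} [MeasurableSpace S] [MeasurableSpace Ω] {P : Measure Ω}
  [IsProbabilityMeasure P] {ξ : ℕ → Ω → S} {κ : ℕ → ℕ → Ω → Measure S} {H : ℕ → Ω × S → ℝ}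
  {M : ℝ≥0} {k : ℕ}

/-- The prediction error of `H s (·, ξ (s + k))` given the first `s` samples. -/
noncomputable def predictionError (ξ : ℕ → Ω → S) (κ : ℕ → ℕ → Ω → Measure S) (H : ℕ → Ω × S → ℝ) (k s : ℕ)
    (ω : Ω) : ℝ :=
  ∫ z, H s (ω, z) ∂κ s (s + k) ω - H s (ω, ξ (s + k) ω)

omit [IsProbabilityMeasure P] in
lemma measurable_sum_predictionError (hκ : ∀ s t, s < t → IsCondLaw P ξ s t (κ s t)) (hk : 1 ≤ k)
    (hH : ∀ s, @Measurable _ _ ((past ξ s).prod inferInstance) _ (H s)) (i n : ℕ) :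
    Measurable[past ξ (i + n * k)] fun ω =>
      ∑ j ∈ Finset.range n, predictionError ξ κ H k (i + j * k) ω := by
  refine Finset.measurable_sum _ fun j hj => ?_
  -- The error indexed `i + j * k` looks at the sample `i + (j + 1) * k`, already past at time `i +
  -- n * k`. This makes the errors in one class martingale differences.
  have hj : (j + 1) * k ≤ n * k := Nat.mul_le_mul_right k (Finset.mem_range.1 hj)
  rw [add_one_mul] at hj
  exact (hκ _ _ (by omega)).measurable_integral_sub (by omega) (by omega) (by omega) (hH _)

lemma lintegral_exp_sum_predictionError_le (hξ : ∀ t, Measurable (ξ t))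
    (hκ : ∀ s t, s < t → IsCondLaw P ξ s t (κ s t)) (hk : 1 ≤ k)
    (hH : ∀ s, @Measurable _ _ ((past ξ s).prod inferInstance) _ (H s))
    (hM : ∀ s p, |H s p| ≤ M) (i n : ℕ) (r : ℝ) :
    ∫⁻ ω, ENNReal.ofReal (Real.exp (r * ∑ j ∈ Finset.range n,
      predictionError ξ κ H k (i + j * k) ω)) ∂P ≤
      ENNReal.ofReal (Real.exp ((n : ℝ) * (M : ℝ) ^ 2 * r ^ 2 / 2)) := by
  induction n with
  | zero => simp
  | succ n ih =>
    have hW : Measurable[past ξ (i + n * k)] fun ω => ENNReal.ofReal (Real.exp (r *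
        ∑ j ∈ Finset.range n, predictionError ξ κ H k (i + j * k) ω)) :=
      (((measurable_sum_predictionError hκ hk hH i n).const_mul r).exp).ennreal_ofReal
    have hstep := (hκ (i + n * k) (i + n * k + k) (by omega)).lintegral_mul_exp_integral_sub_le hξ hW
      (hH _) (hM _) r
    calc _ = _ := by
            refine lintegral_congr fun ω => ?_
            rw [Finset.sum_range_succ, mul_add, Real.exp_add,
              ENNReal.ofReal_mul (Real.exp_pos _).le]
            rfl
      _ ≤ _ := hstep
      _ ≤ ENNReal.ofReal (Real.exp ((M : ℝ) ^ 2 * r ^ 2 / 2)) *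
          ENNReal.ofReal (Real.exp ((n : ℝ) * (M : ℝ) ^ 2 * r ^ 2 / 2)) := by gcongr
      _ = _ := by
            rw [← ENNReal.ofReal_mul (Real.exp_pos _).le, ← Real.exp_add]
            congr 2
            push_cast
            ring

/-- Azuma's inequality along each of the `k` residue classes, combined without independence. -/
lemma hasSubgaussianMGF_sum_predictionError (hξ : ∀ t, Measurable (ξ t))
    (hκ : ∀ s t, s < t → IsCondLaw P ξ s t (κ s t)) (hk : 1 ≤ k)
    (hH : ∀ s, @Measurable _ _ ((past ξ s).prod inferInstance) _ (H s))
    (hM : ∀ s p, |H s p| ≤ M) (n : ℕ) :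
    HasSubgaussianMGF (fun ω => ∑ s ∈ Finset.range (k * n), predictionError ξ κ H k s ω)
      ((k : ℝ≥0) ^ 2 * (n * M ^ 2)) P := by
  simp_rw [sum_range_mul_eq_sum_residues]
  refine hasSubgaussianMGF_sum_range (fun i => ?_) k
  refine hasSubgaussianMGF_of_lintegral_le
    ((measurable_sum_predictionError hκ hk hH i n).mono (past_le hξ _) le_rfl) fun r => ?_
  simpa using lintegral_exp_sum_predictionError_le hξ hκ hk hH hM i n r

/-- The Chernoff exponent with parameter `k² n M²` is `8 (T / (k n)) log (k / δ)`, which exceeds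
`log (1 / δ)` since `k n ≤ T`. No union bound over classes is taken, so the constant `4` and the `k`
inside the logarithm both leave room. -/
lemma one_sub_le_measureReal_sum_predictionError_le (hξ : ∀ t, Measurable (ξ t))
    (hκ : ∀ s t, s < t → IsCondLaw P ξ s t (κ s t)) (hk : 1 ≤ k)
    (hH : ∀ s, @Measurable _ _ ((past ξ s).prod inferInstance) _ (H s))
    (hM : ∀ s p, |H s p| ≤ M) {n T : ℕ} (hn : 1 ≤ n) (hT : k * n ≤ T) {δ : ℝ} (hδ₀ : 0 < δ)
    (hδ₁ : δ < 1) :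
    1 - δ ≤ P.real {ω | ∑ s ∈ Finset.range (k * n), predictionError ξ κ H k s ω ≤
      4 * M * Real.sqrt (k * T * Real.log (k / δ))} := by
  set u := 4 * M * Real.sqrt (k * T * Real.log (k / δ)) with hu
  have hk' : (1 : ℝ) ≤ k := by exact_mod_cast hk
  have hn' : (1 : ℝ) ≤ n := by exact_mod_cast hn
  have hT' : (k : ℝ) * n ≤ T := by exact_mod_cast hT
  have hlog : Real.log (1 / δ) ≤ Real.log (k / δ) :=
    Real.log_le_log (by positivity) (by gcongr)
  have hlog0 : 0 < Real.log (1 / δ) := Real.log_pos (by rw [lt_div_iff₀ hδ₀]; linarith)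
  have hu0 : 0 ≤ u := by positivity
  -- For `M = 0` the tail bound divides by zero and says nothing, but then all errors vanish.
  rcases eq_or_ne M 0 with hM0 | hM0
  · have hH0 : ∀ s p, H s p = 0 := fun s p => by
      have := hM s p
      rw [hM0, NNReal.coe_zero] at this
      exact abs_nonpos_iff.1 this
    have huniv : {ω | ∑ s ∈ Finset.range (k * n), predictionError ξ κ H k s ω ≤ u} = Set.univ := by
      ext ω
      simpa [predictionError, hH0] using hu0
    rw [huniv, probReal_univ]
    linarith
  have hMpos : 0 < (M : ℝ) := by exact_mod_cast pos_iff_ne_zero.2 hM0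
  have hsub := hasSubgaussianMGF_sum_predictionError hξ hκ hk hH hM n
  have htail := hsub.measure_ge_le hu0
  set A := {ω | ∑ s ∈ Finset.range (k * n), predictionError ξ κ H k s ω ≤ u}
  have hexp : Real.exp (-u ^ 2 / (2 * (((k : ℝ≥0) ^ 2 * (n * M ^ 2) : ℝ≥0) : ℝ))) ≤ δ := by
    rw [← Real.le_log_iff_exp_le hδ₀, neg_div, neg_le]
    rw [one_div, Real.log_inv] at hlog hlog0
    refine hlog.trans ?_
    have husq : u ^ 2 = 16 * M ^ 2 * (k * T * Real.log (k / δ)) := by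
      rw [hu, mul_pow, Real.sq_sqrt (mul_nonneg (by positivity) (hlog0.le.trans hlog))]
      ring
    push_cast
    rw [husq, le_div_iff₀ (by positivity)]
    have h1 := mul_le_mul_of_nonneg_left hT'
      (show (0 : ℝ) ≤ 2 * M ^ 2 * k * Real.log (k / δ) by
        have := hlog0.le.trans hlog
        positivity)
    have h2 : (0 : ℝ) ≤ 14 * M ^ 2 * (k * T * Real.log (k / δ)) := by
      have := hlog0.le.trans hlog
      positivity
    nlinarith
  have hcover : (1 : ℝ) ≤ P.real A + P.real {ω | u ≤ ∑ s ∈ Finset.range (k * n),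
      predictionError ξ κ H k s ω} := by
    rw [← probReal_univ (μ := P)]
    refine (measureReal_mono fun ω _ => ?_).trans (measureReal_union_le _ _)
    exact le_total (∑ s ∈ Finset.range (k * n), predictionError ξ κ H k s ω) u
  linarith

end Concentration

lemma sum_Icc_one_eq_sum_range (f : ℕ → ℝ) (n : ℕ) :
    ∑ t ∈ Finset.Icc 1 n, f t = ∑ s ∈ Finset.range n, f (s + 1) := by
  induction n with
  | zero => simp
  | succ n ih => rw [Finset.sum_Icc_succ_top (by omega), Finset.sum_range_succ, ih]

lemma sum_Icc_eq_sum_range (f : ℕ → ℝ) {m n N : ℕ} (h : N + m = n + 1) :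
    ∑ t ∈ Finset.Icc m n, f t = ∑ s ∈ Finset.range N, f (s + m) := by
  rw [← Finset.Ico_add_one_right_eq_Icc, Finset.sum_Ico_eq_sum_range,
    show n + 1 - m = N by omega]
  simp_rw [add_comm]

/-! ### Stability and regret of the iterates. -/

section Regret

variable {E S Ω : Type*} [NormedAddCommGroup E] [NormedSpace ℝ E] {X : Set E} {ψ : E → ℝ} {R : ℝ}
  {F : E → S → ℝ} {g : E → S → (E →L[ℝ] ℝ)} {ξ : ℕ → Ω → S} {G : ℝ≥0} {α : ℕ → ℝ} {x₁ : E}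
  {x : ℕ → Ω → E} {ω : Ω}

lemma IsErgodicMirrorDescent.norm_sub_le (hx : IsErgodicMirrorDescent X ψ α g ξ x₁ x)
    (hXconvex : Convex ℝ X) (hψ : IsProxFunction X ψ R) (hα : IsStepsize α)
    (hLip : ∀ t, 1 ≤ t → LipschitzAt X F g G (ξ t ω)) {s : ℕ} (hs : 1 ≤ s) (k : ℕ) :
    ‖x s ω - x (s + k) ω‖ ≤ k * (α s * G) := by
  induction k with
  | zero => simp
  | succ k ih =>
    have hsk : 1 ≤ s + k := by omega
    have hmem := hx.mem hsk ω
    have hstep := (hx.step (s + k) hsk ω).norm_sub_le hXconvex hψ (hα.pos _ hsk) hmem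
      ((hLip _ hsk).dual_norm_le _ hmem)
    have hmono := mul_le_mul_of_nonneg_right (hα.noninc s (s + k) hs (by omega)) G.coe_nonneg
    have htri := norm_sub_le_norm_sub_add_norm_sub (x s ω) (x (s + k) ω) (x (s + k + 1) ω)
    rw [← add_assoc]
    push_cast
    linarith

/-- Linearize each loss by its subgradient, apply the one-step bound and sum by parts. The start `m`
is free because the delayed losses only begin at time `k`. -/
lemma IsErgodicMirrorDescent.regret_le (hx : IsErgodicMirrorDescent X ψ α g ξ x₁ x)
    (hXconvex : Convex ℝ X) (hψ : IsProxFunction X ψ R) (hα : IsStepsize α)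
    (hLip : ∀ t, 1 ≤ t → LipschitzAt X F g G (ξ t ω)) {y : E} (hy : y ∈ X) {m n : ℕ}
    (hm : 1 ≤ m) (hmn : m ≤ n) :
    ∑ t ∈ Finset.Icc m n, (F (x t ω) (ξ t ω) - F y (ξ t ω)) ≤
      R ^ 2 / (2 * α n) + (G : ℝ) ^ 2 / 2 * ∑ t ∈ Finset.Icc 1 n, α t := by
  have hterm : ∀ t ∈ Finset.Icc m n, F (x t ω) (ξ t ω) - F y (ξ t ω) ≤
      (1 / α t) * (bregman X ψ y (x t ω) - bregman X ψ y (x (t + 1) ω)) +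
        (G : ℝ) ^ 2 / 2 * α t := by
    intro t ht
    have ht1 : 1 ≤ t := hm.trans (Finset.mem_Icc.1 ht).1
    have hmem := hx.mem ht1 ω
    have h1 := (hx.step t ht1 ω).apply_sub_le hXconvex hψ (hα.pos t ht1) hmem
      ((hLip t ht1).dual_norm_le _ hmem) hy
    have h2 := (hLip t ht1).subgradient _ hmem y hy
    rw [map_sub] at h1 h2
    linarith
  refine (Finset.sum_le_sum hterm).trans ?_
  rw [Finset.sum_add_distrib, ← Finset.mul_sum]
  refine add_le_add ?_ (mul_le_mul_of_nonneg_left ?_ (by positivity))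
  · refine (hα.sum_one_div_mul_sub_le (D := fun t => bregman X ψ y (x t ω))
      (B := (1 / 2) * R ^ 2) hm (fun t ht => hψ.bregman_nonneg hy (hx.mem ht ω))
      (fun t ht => hψ.radius y hy _ (hx.mem ht ω)) hmn).trans (le_of_eq ?_)
    have := hα.pos n (hm.trans hmn)
    field_simp
  · exact Finset.sum_le_sum_of_subset_of_nonneg (Finset.Icc_subset_Icc_left hm)
      fun t ht _ => (hα.pos t (Finset.mem_Icc.1 ht).1).le

end Regret

/-! ### A jointly measurable version of the losses; convexity of the objective. -/

section Loss

variable {E S : Type*} [NormedAddCommGroup E] [NormedSpace ℝ E] [MeasurableSpace S]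
  {X : Set E} {F : E → S → ℝ} {G : ℝ≥0} {π : Measure S}

/-- The loss differences agree, off the samples with non-Lipschitz losses, with a jointly measurable
bounded function. -/
lemma exists_measurable_eq_loss_sub [FiniteDimensional ℝ E] [MeasurableSpace E] [BorelSpace E]
    (hFmeas : ∀ x ∈ X, Measurable (F x)) {y : E} (hy : y ∈ X) {R : ℝ} (hR : 0 ≤ R)
    (hdiam : ∀ x ∈ X, ‖x - y‖ ≤ R) :
    ∃ H : E × S → ℝ, Measurable H ∧ (∀ p, |H p| ≤ G * R) ∧
      ∀ z, LipschitzOnWith G (fun x => F x z) X → ∀ x ∈ X, H (x, z) = F x z - F y z := by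
  obtain ⟨D, hDX, hDc, hD⟩ :=
    (TopologicalSpace.IsSeparable.of_separableSpace X).exists_countable_dense_subset
  have := hDc.to_subtype
  have hDne : Nonempty D := (closure_nonempty_iff.1 ⟨y, hD hy⟩).to_subtype
  -- McShane extension from a countable dense set: jointly measurable, and equal to `F` on `X`
  -- wherever the loss is Lipschitz. Clipping `K - F y` to `[-G R, G R]` below changes nothing there
  -- and gives a bound at every sample, whatever the conditional laws charge.
  set K : E × S → ℝ := fun p => ⨅ d : D, (F d p.2 + G * ‖p.1 - d‖)
  have hK : Measurable K := Measurable.iInf fun d =>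
    ((hFmeas d (hDX d.2)).comp measurable_snd).add
      ((measurable_fst.sub_const _).norm.const_mul _)
  have hKeq : ∀ z, LipschitzOnWith G (fun x => F x z) X → ∀ x ∈ X, K (x, z) = F x z := by
    intro z hz x hx
    have hlow : ∀ d : D, F x z ≤ F d z + G * ‖x - d‖ := by
      intro d
      have := hz.dist_le_mul x hx d (hDX d.2)
      rw [Real.dist_eq, dist_eq_norm] at this
      linarith [(abs_le.1 this).2]
    refine le_antisymm ?_ (le_ciInf hlow)
    have hcont : ContinuousOn (fun d => F d z + G * ‖x - d‖) X := by
      have := hz.continuousOn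
      fun_prop
    have := le_of_forall_dense_le hcont hDX hD (b := K (x, z))
      (fun d hd => ciInf_le (⟨F x z, by rintro _ ⟨d, rfl⟩; exact hlow d⟩ :
        BddBelow (Set.range fun d : D => F d z + G * ‖x - d‖)) ⟨d, hd⟩) hx
    simpa using this
  have hGR : 0 ≤ G * R := by positivity
  refine ⟨fun p => max (-(G * R)) (min (G * R) (K p - F y p.2)), ?_, ?_, ?_⟩
  · have : Measurable fun p : E × S => F y p.2 := (hFmeas y hy).comp measurable_snd
    exact measurable_const.max (measurable_const.min (hK.sub this))
  · intro p
    exact abs_le.2 ⟨le_max_left _ _, max_le (by linarith) (min_le_left _ _)⟩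
  · intro z hz x hx
    have h1 := hz.dist_le_mul x hx y hy
    rw [Real.dist_eq, dist_eq_norm] at h1
    have h2 := abs_le.1 (h1.trans (mul_le_mul_of_nonneg_left (hdiam x hx) G.coe_nonneg))
    simp only [hKeq z hz x hx]
    rw [min_eq_right h2.2, max_eq_right h2.1]

lemma convexOn_objective (hXconvex : Convex ℝ X) (hF : ∀ z, ConvexOn ℝ X (fun x => F x z))
    (hFint : ∀ x ∈ X, Integrable (F x) π) : ConvexOn ℝ X (objective F π) := by
  refine ⟨hXconvex, fun x hx y hy a b ha hb hab => ?_⟩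
  unfold objective
  rw [smul_eq_mul, smul_eq_mul, ← integral_const_mul, ← integral_const_mul,
    ← integral_add ((hFint x hx).const_mul a) ((hFint y hy).const_mul b)]
  refine integral_mono (hFint _ (hXconvex hx hy ha hb hab))
    (((hFint x hx).const_mul a).add ((hFint y hy).const_mul b)) fun z => ?_
  exact (hF z).2 hx hy ha hb hab

lemma map_average_le_of_convexOn {f : E → ℝ} (hf : ConvexOn ℝ X f) {Ω : Type*} {x : ℕ → Ω → E}
    {T : ℕ} (hT : 1 ≤ T) {ω : Ω} (hx : ∀ t, 1 ≤ t → x t ω ∈ X) :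
    f (average x T ω) ≤ (1 / (T : ℝ)) * ∑ t ∈ Finset.Icc 1 T, f (x t ω) := by
  have hT' : (T : ℝ) ≠ 0 := by positivity
  unfold average
  rw [Finset.smul_sum, Finset.mul_sum]
  refine hf.map_sum_le (fun _ _ => by positivity) ?_ fun t ht => hx t (Finset.mem_Icc.1 ht).1
  simp [hT']

end Loss

/-- The infimum defining the mixing time runs over `k ≥ 1` and is `⊤` when empty. -/
lemma IsUniformMixingTime.one_le {S Ω : Type*} [MeasurableSpace S] [MeasurableSpace Ω]
    {P : Measure Ω} [NeZero P] {κ : ℕ → ℕ → Ω → Measure S} {π : Measure S} {τ : ℝ → ℕ}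
    (hτ : IsUniformMixingTime P κ π τ) {ε : ℝ} (hε : 0 < ε) : 1 ≤ τ ε := by
  obtain ⟨ω, hω⟩ := (hτ.mixingTime_le ε hε).exists
  have h : (1 : ℕ∞) ≤ tvMixingTime κ π 0 ε ω :=
    le_iInf₂ fun k hk => by exact_mod_cast hk.1
  exact_mod_cast h.trans (hω 0)

/-! ### Delayed regret and the truncated losses. -/

section Decomposition

variable {E S Ω : Type*} [NormedAddCommGroup E] [NormedSpace ℝ E]
  {X : Set E} {ψ : E → ℝ} {R : ℝ} {F : E → S → ℝ} {g : E → S → (E →L[ℝ] ℝ)} {ξ : ℕ → Ω → S}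
  {G : ℝ≥0} {α : ℕ → ℝ} {x₁ : E} {x : ℕ → Ω → E} {ω : Ω}

/-- Regret on the loss sampled `k - 1` steps ahead of the iterate. -/
lemma IsErgodicMirrorDescent.sum_delayed_regret_le (hx : IsErgodicMirrorDescent X ψ α g ξ x₁ x)
    (hXconvex : Convex ℝ X) (hψ : IsProxFunction X ψ R) (hα : IsStepsize α)
    (hLip : ∀ t, 1 ≤ t → LipschitzAt X F g G (ξ t ω)) {y : E} (hy : y ∈ X) {k T N : ℕ}
    (hk : 1 ≤ k) (hN : N + k = T + 1) (hkT : k ≤ T) :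
    ∑ s ∈ Finset.range N, (F (x (s + 1) ω) (ξ (s + k) ω) - F y (ξ (s + k) ω)) ≤
      R ^ 2 / (2 * α T) + (G : ℝ) ^ 2 / 2 * ∑ t ∈ Finset.Icc 1 T, α t +
        ((k : ℝ) - 1) * ((G : ℝ) ^ 2 * ∑ t ∈ Finset.Icc 1 T, α t) := by
  have hregret := hx.regret_le hXconvex hψ hα hLip hy hk hkT
  rw [sum_Icc_eq_sum_range _ hN] at hregret
  -- From `x (s + 1)` to `x (s + k)` there are `k - 1` steps, each of length at most `α (s + 1) *
  -- G`.
  have hstab : ∑ s ∈ Finset.range N, (F (x (s + 1) ω) (ξ (s + k) ω) -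
      F (x (s + k) ω) (ξ (s + k) ω)) ≤
      ((k : ℝ) - 1) * ((G : ℝ) ^ 2 * ∑ t ∈ Finset.Icc 1 T, α t) := by
    have hterm : ∀ s ∈ Finset.range N, F (x (s + 1) ω) (ξ (s + k) ω) -
        F (x (s + k) ω) (ξ (s + k) ω) ≤ ((k : ℝ) - 1) * ((G : ℝ) ^ 2 * α (s + 1)) := by
      intro s _
      have h1 := (hLip (s + k) (by omega)).lipschitz.dist_le_mul _ (hx.mem (by omega : 1 ≤ s + 1) ω)
        _ (hx.mem (by omega : 1 ≤ s + k) ω)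
      have h2 := hx.norm_sub_le hXconvex hψ hα hLip (by omega : 1 ≤ s + 1) (k - 1)
      rw [show s + 1 + (k - 1) = s + k by omega, Nat.cast_sub hk, Nat.cast_one] at h2
      rw [Real.dist_eq, dist_eq_norm] at h1
      have h3 := (le_abs_self _).trans (h1.trans (mul_le_mul_of_nonneg_left h2 G.coe_nonneg))
      refine h3.trans (le_of_eq ?_)
      ring
    refine (Finset.sum_le_sum hterm).trans ?_
    rw [← Finset.mul_sum, ← Finset.mul_sum, sum_Icc_one_eq_sum_range]
    have hk1 : (0 : ℝ) ≤ (k : ℝ) - 1 := sub_nonneg.2 (by exact_mod_cast hk)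
    gcongr with s hs
    · intro s _ _
      exact (hα.pos (s + 1) (by omega)).le
    · omega
  have hsplit : ∑ s ∈ Finset.range N, (F (x (s + 1) ω) (ξ (s + k) ω) - F y (ξ (s + k) ω)) =
      ∑ s ∈ Finset.range N, (F (x (s + 1) ω) (ξ (s + k) ω) - F (x (s + k) ω) (ξ (s + k) ω)) +
      ∑ s ∈ Finset.range N, (F (x (s + k) ω) (ξ (s + k) ω) - F y (ξ (s + k) ω)) := by
    rw [← Finset.sum_add_distrib]
    exact Finset.sum_congr rfl fun s _ => by ring
  linarith

end Decomposition

/-- The function predicted in the concentration bound: the value of `H` at the iterate, as long as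
the sample `k` steps ahead is available. -/
def truncatedLoss {E S Ω : Type*} (H : E × S → ℝ) (x : ℕ → Ω → E) (N s : ℕ) (p : Ω × S) : ℝ :=
  if s < N then H (x (s + 1) p.1, p.2) else 0

lemma measurable_truncatedLoss {E S Ω : Type*} [MeasurableSpace E] [MeasurableSpace S]
    {H : E × S → ℝ} (hH : Measurable H) {ξ : ℕ → Ω → S} {x : ℕ → Ω → E} {N s : ℕ}
    (hx : Measurable[past ξ s] (x (s + 1))) :
    @Measurable _ _ ((past ξ s).prod inferInstance) _ (truncatedLoss H x N s) := by
  let _ : MeasurableSpace Ω := past ξ s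
  unfold truncatedLoss
  split_ifs
  · exact hH.comp ((hx.comp measurable_fst).prodMk measurable_snd)
  · exact measurable_const

lemma sum_predictionError_truncatedLoss {E S Ω : Type*} [MeasurableSpace S] (H : E × S → ℝ)
    (ξ : ℕ → Ω → S) (κ : ℕ → ℕ → Ω → Measure S) (x : ℕ → Ω → E) (k : ℕ) {N n : ℕ} (hN : N ≤ n)
    (ω : Ω) :
    ∑ s ∈ Finset.range n, predictionError ξ κ (truncatedLoss H x N) k s ω =
      ∑ s ∈ Finset.range N, (∫ z, H (x (s + 1) ω, z) ∂κ s (s + k) ω -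
        H (x (s + 1) ω, ξ (s + k) ω)) := by
  rw [← Finset.sum_subset (Finset.range_mono hN)]
  · refine Finset.sum_congr rfl fun s hs => ?_
    simp [predictionError, truncatedLoss, Finset.mem_range.1 hs]
  · intro s _ hs
    have : ¬ s < N := by simpa using hs
    simp [predictionError, truncatedLoss, this]

end EMD

/-! ### Assembly of the high-probability bound. -/

theorem theorem2
    {E : Type*} [NormedAddCommGroup E] [NormedSpace ℝ E] [FiniteDimensional ℝ E]
    [MeasurableSpace E] [BorelSpace E]
    {S Ω : Type*} [MeasurableSpace S] [MeasurableSpace Ω]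
    -- the domain and the prox-function
    (X : Set E) (hXcompact : IsCompact X) (hXconvex : Convex ℝ X)
    (ψ : E → ℝ) (R : ℝ) (hR : 0 ≤ R) (hψ : EMD.IsProxFunction X ψ R)
    -- the loss functions, their subgradient selection and the stationary distribution
    (π : Measure S) [IsProbabilityMeasure π]
    (F : E → S → ℝ) (hFconvex : ∀ z, ConvexOn ℝ X (fun x => F x z))
    (hFmeas : ∀ x ∈ X, Measurable (F x)) (hFint : ∀ x ∈ X, Integrable (F x) π)
    (g : E → S → (E →L[ℝ] ℝ)) (hgmeas : Measurable (fun p : X × S => g p.1 p.2))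
    -- the stochastic process and its conditional laws
    (P : Measure Ω) [IsProbabilityMeasure P]
    (ξ : ℕ → Ω → S) (hξ : ∀ t, Measurable (ξ t))
    (κ : ℕ → ℕ → Ω → Measure S) (hκ : ∀ s t, s < t → EMD.IsCondLaw P ξ s t (κ s t))
    -- Lipschitz losses
    (G : ℝ≥0) (hπLip : ∀ᵐ z ∂π, LipschitzOnWith G (fun x => F x z) X)
    (hξLip : ∀ t, 1 ≤ t → ∀ᵐ ω ∂P, EMD.LipschitzAt X F g G (ξ t ω))
    -- uniform mixing
    (τ : ℝ → ℕ) (hτ : EMD.IsUniformMixingTime P κ π τ)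
    -- the algorithm
    (α : ℕ → ℝ) (hα : EMD.IsStepsize α)
    (x₁ : E) (x : ℕ → Ω → E) (hx : EMD.IsErgodicMirrorDescent X ψ α g ξ x₁ x)
    (xstar : E) (hxstar : xstar ∈ X)
    (δ : ℝ) (hδ₀ : 0 < δ) (hδ₁ : δ < 1)
    (T : ℕ) (ε : ℝ) (hε : 0 < ε) (hT : (τ ε : ℝ) ≤ (T : ℝ) / 2) :
    1 - δ ≤ P.real {ω |
      EMD.objective F π (EMD.average x T ω) - EMD.objective F π xstar ≤
        R ^ 2 / (2 * T * α T)
        + (G : ℝ) ^ 2 / (2 * T) * ∑ t ∈ Finset.Icc 1 T, α t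
        + ((τ ε : ℝ) - 1) / T * ((G : ℝ) ^ 2 * ∑ t ∈ Finset.Icc 1 T, α t + G * R)
        + ε * G * R
        + 4 * G * R * Real.sqrt ((τ ε : ℝ) * Real.log ((τ ε : ℝ) / δ) / T)} := by
  set k := τ ε with hkdef
  have hk : 1 ≤ k := hτ.one_le hε
  have hkT : 2 * k ≤ T := by
    have : ((2 * k : ℕ) : ℝ) ≤ T := by push_cast; linarith
    exact_mod_cast this
  have hT1 : 1 ≤ T := by omega
  have hTpos : (0 : ℝ) < T := by exact_mod_cast hT1
  -- `N` counts the `s ≥ 0` with `s + k ≤ T`. Concentration wants a full `k * n` terms; this covers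
  -- `N`, and `truncatedLoss` makes the surplus terms zero.
  obtain ⟨N, hN⟩ : ∃ N, N + k = T + 1 := ⟨T + 1 - k, by omega⟩
  set n := T / k with hndef
  have hnT : k * n ≤ T := Nat.mul_div_le T k
  have hn : 1 ≤ n := (Nat.one_le_div_iff (by omega)).2 (by omega)
  have hNn : N ≤ k * n := by
    have := Nat.lt_mul_div_succ T (show 0 < k by omega)
    rw [mul_add_one, ← hndef] at this
    omega
  obtain ⟨H, hHm, hHbound, hHeq⟩ := EMD.exists_measurable_eq_loss_sub (G := G) hFmeas hxstar hR
    fun y hy => hψ.norm_sub_le hR hy hxstar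
  have hobj : ∀ y ∈ X, EMD.objective F π y - EMD.objective F π xstar = ∫ z, H (y, z) ∂π := by
    intro y hy
    unfold EMD.objective
    rw [← integral_sub (hFint y hy) (hFint xstar hxstar)]
    exact integral_congr_ae (hπLip.mono fun z hz => (hHeq z hz y hy).symm)
  let M : ℝ≥0 := G * ⟨R, hR⟩
  have hM : (M : ℝ) = G * R := rfl
  have hM0 : (0 : ℝ) ≤ G * R := hM ▸ M.coe_nonneg
  have hprob := EMD.one_sub_le_measureReal_sum_predictionError_le (M := M) hξ hκ hk
    (H := EMD.truncatedLoss H x N)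
    (fun s => EMD.measurable_truncatedLoss hHm
      (hx.measurable hXcompact hXconvex hψ hα hgmeas s))
    (fun s p => by
      unfold EMD.truncatedLoss
      split_ifs
      · exact hHbound _
      · simp) hn hnT hδ₀ hδ₁
  refine hprob.trans ?_
  simp only [measureReal_def]
  -- Off a null set, the concentration event is contained in the event of the theorem; the rest is
  -- deterministic.
  refine ENNReal.toReal_mono (measure_ne_top _ _) (measure_mono_ae ?_)
  filter_upwards [ae_all_iff.2 fun t => ae_all_iff.2 fun ht => hξLip t ht, hτ.close ε hε]
    with ω hLip hclose hconc
  have hconc : ∑ s ∈ Finset.range (k * n), EMD.predictionError ξ κ (EMD.truncatedLoss H x N) k s ω ≤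
      4 * M * Real.sqrt (k * T * Real.log (k / δ)) := hconc
  rw [EMD.sum_predictionError_truncatedLoss H ξ κ x k hNn ω, hM] at hconc
  have hmem : ∀ t, 1 ≤ t → x t ω ∈ X := fun t ht => hx.mem ht ω
  have hdelayed := hx.sum_delayed_regret_le hXconvex hψ hα hLip hxstar hk hN (by omega)
  have hhead : ∑ s ∈ Finset.range N, (EMD.objective F π (x (s + 1) ω) - EMD.objective F π xstar) ≤
      ∑ s ∈ Finset.range N, (∫ z, H (x (s + 1) ω, z) ∂κ s (s + k) ω -
        H (x (s + 1) ω, ξ (s + k) ω)) +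
      ∑ s ∈ Finset.range N, (F (x (s + 1) ω) (ξ (s + k) ω) - F xstar (ξ (s + k) ω)) +
      T * (ε * G * R) := by
    have hterm : ∀ s ∈ Finset.range N,
        EMD.objective F π (x (s + 1) ω) - EMD.objective F π xstar ≤
        (∫ z, H (x (s + 1) ω, z) ∂κ s (s + k) ω - H (x (s + 1) ω, ξ (s + k) ω)) +
        (F (x (s + 1) ω) (ξ (s + k) ω) - F xstar (ξ (s + k) ω)) + ε * G * R := by
      intro s _
      have hs := hmem (s + 1) (by omega)
      have := (hκ s (s + k) (by omega)).isProbabilityMeasure ω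
      have htv := EMD.abs_integral_sub_le_mul_tvDist (κ s (s + k) ω) π
        (hHm.comp (measurable_prodMk_left (x := x (s + 1) ω))) (fun z => hHbound _)
      have htv' := (abs_le.1 (htv.trans (mul_le_mul_of_nonneg_left (hclose s) hM0))).1
      rw [hobj _ hs, hHeq _ (hLip (s + k) (by omega)).lipschitz _ hs]
      simp only [Function.comp_apply] at htv'
      linarith
    refine (Finset.sum_le_sum hterm).trans ?_
    rw [Finset.sum_add_distrib, Finset.sum_add_distrib]
    simp only [Finset.sum_const, Finset.card_range, nsmul_eq_mul]
    have hNT : (N : ℝ) ≤ T := by exact_mod_cast (show N ≤ T by omega)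
    have : (0 : ℝ) ≤ ε * G * R := by positivity
    gcongr
  -- The last `T - N = k - 1` iterates have no sample `k` ahead within the horizon; they are bounded
  -- through the diameter.
  have htail : ∑ s ∈ Finset.Ico N T, (EMD.objective F π (x (s + 1) ω) - EMD.objective F π xstar) ≤
      ((k : ℝ) - 1) * (G * R) := by
    have hterm : ∀ s ∈ Finset.Ico N T,
        EMD.objective F π (x (s + 1) ω) - EMD.objective F π xstar ≤ G * R := by
      intro s _
      rw [hobj _ (hmem (s + 1) (by omega))]
      refine (le_abs_self _).trans ?_
      simpa using norm_integral_le_of_norm_le_const (μ := π) (f := fun z => H (x (s + 1) ω, z))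
        (ae_of_all _ fun z => hHbound (x (s + 1) ω, z))
    refine (Finset.sum_le_card_nsmul _ _ _ hterm).trans (le_of_eq ?_)
    rw [Nat.card_Ico, show T - N = k - 1 by omega, nsmul_eq_mul, Nat.cast_sub hk, Nat.cast_one]
  have hsum : ∑ t ∈ Finset.Icc 1 T, (EMD.objective F π (x t ω) - EMD.objective F π xstar) =
      ∑ s ∈ Finset.range N, (EMD.objective F π (x (s + 1) ω) - EMD.objective F π xstar) +
      ∑ s ∈ Finset.Ico N T, (EMD.objective F π (x (s + 1) ω) - EMD.objective F π xstar) := by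
    rw [EMD.sum_Icc_one_eq_sum_range, Finset.sum_range_add_sum_Ico _ (by omega)]
  have havg := EMD.map_average_le_of_convexOn
    (EMD.convexOn_objective hXconvex hFconvex hFint) hT1 hmem
  have hsum' : ∑ t ∈ Finset.Icc 1 T, (EMD.objective F π (x t ω) - EMD.objective F π xstar) =
      ∑ t ∈ Finset.Icc 1 T, EMD.objective F π (x t ω) - T * EMD.objective F π xstar := by
    simp
  have hαT := hα.pos T hT1
  have hsqrt : Real.sqrt (k * Real.log (k / δ) / T) = Real.sqrt (k * T * Real.log (k / δ)) / T := by
    rw [show (k : ℝ) * Real.log (k / δ) / T = k * T * Real.log (k / δ) / T ^ 2 by field_simp,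
      Real.sqrt_div' _ (by positivity), Real.sqrt_sq hTpos.le]
  show EMD.objective F π (EMD.average x T ω) - EMD.objective F π xstar ≤ _
  set A := ∑ t ∈ Finset.Icc 1 T, α t
  rw [hsqrt]
  calc EMD.objective F π (EMD.average x T ω) - EMD.objective F π xstar
      ≤ (1 / (T : ℝ)) * (∑ t ∈ Finset.Icc 1 T, EMD.objective F π (x t ω) -
          T * EMD.objective F π xstar) := by
        rw [mul_sub, ← mul_assoc, one_div_mul_cancel hTpos.ne', one_mul]
        linarith
    _ ≤ (1 / (T : ℝ)) * (4 * (G * R) * Real.sqrt (k * T * Real.log (k / δ)) +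
          (R ^ 2 / (2 * α T) + (G : ℝ) ^ 2 / 2 * A + ((k : ℝ) - 1) * ((G : ℝ) ^ 2 * A)) +
          T * (ε * G * R) + ((k : ℝ) - 1) * (G * R)) := by
        gcongr
        linarith
    _ = _ := by
        field_simp
        ring
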